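/- Embed $\mathbf G_m^2=(\mathbf C^\times)^2$ in the complex projective plane $\mathbf P^2$ by $(x,y)\mapsto[1:x:y]$. Let $V\subset\mathbf P^2$ be an irreducible curve (the zero locus of an irreducible homogeneous polynomial in $\mathbf C[X_0,X_1,X_2]$) that contains infinitely many torsion points of $\mathbf G_m^2$ (points of finite order of the group). Then $V$ is the Zariski closure in $\mathbf P^2$ of a translate $tH$ of a subtorus $H\subset\mathbf G_m^2$ (a connected Zariski-closed subgroup) by a torsion point $t\in\mathbf G_m^2$. More explicitly, there are coprime integers $a,b\in\mathbf Z$ and a root of unity $u\in\mathbf C$ such that $$V\cap\mathbf G_m^2=\{(x,y)\in\mathbf G_m^2 : x^ay^b=u\}.$$ -/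

import Mathlib

open scoped LinearAlgebra.Projectivization Topology

noncomputable section

namespace PlaneTorus

/-- The set of points of the complex projective plane. -/
abbrev P2 : Type := ℙ ℂ (Fin 3 → ℂ)

/-- `F` vanishes at the point `P`, tested on a vector of homogeneous coordinates of `P`. Only used
for homogeneous `F`, where the choice of the coordinates is irrelevant (`vanishesAt_mk`). -/
def VanishesAt (F : MvPolynomial (Fin 3) ℂ) (P : P2) : Prop :=
  MvPolynomial.eval P.rep F = 0

theorem vanishesAt_mk {F : MvPolynomial (Fin 3) ℂ} {n : ℕ} (hF : F.IsHomogeneous n)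
    (v : Fin 3 → ℂ) (hv : v ≠ 0) :
    VanishesAt F (Projectivization.mk ℂ v hv) ↔ MvPolynomial.eval v F = 0 := by
  obtain ⟨a, ha⟩ := Projectivization.exists_smul_eq_mk_rep ℂ v hv
  have h : MvPolynomial.eval ((a : ℂ) • v) F = (a : ℂ) ^ n * MvPolynomial.eval v F := by
    rw [MvPolynomial.eval_eq, MvPolynomial.eval_eq, Finset.mul_sum]
    refine Finset.sum_congr rfl fun d hd => ?_
    have hd' : ∑ i ∈ d.support, d i = n := by
      have h1 := hF (MvPolynomial.mem_support_iff.mp hd)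
      simpa [Finsupp.weight_apply, Finsupp.sum] using h1
    simp only [Pi.smul_apply, smul_eq_mul, mul_pow, Finset.prod_mul_distrib,
      Finset.prod_pow_eq_pow_sum, hd']
    ring
  unfold VanishesAt
  rw [← ha, Units.smul_def, h]
  simp

/-- `F` is a form, that is, a homogeneous polynomial of some degree. -/
def IsForm (F : MvPolynomial (Fin 3) ℂ) : Prop := ∃ n : ℕ, F.IsHomogeneous n

/-- The common zeros in the projective plane of a set of polynomials. -/
def zeroLocus (S : Set (MvPolynomial (Fin 3) ℂ)) : Set P2 :=
  {P | ∀ F ∈ S, VanishesAt F P}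

/-- The Zariski topology of the projective plane: the closed sets are the zero loci of sets of
forms. -/
abbrev zariski : TopologicalSpace P2 :=
  TopologicalSpace.ofClosed {Z | ∃ S, (∀ F ∈ S, IsForm F) ∧ Z = zeroLocus S}
    (by
      refine ⟨{1}, ?_, ?_⟩
      · rintro F rfl
        exact ⟨0, MvPolynomial.isHomogeneous_one _ _⟩
      · ext P
        simp [zeroLocus, VanishesAt])
    (by
      intro A hA
      refine ⟨{F | IsForm F ∧ ∃ Z ∈ A, ∀ P ∈ Z, VanishesAt F P}, fun F hF => hF.1, ?_⟩
      ext P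
      constructor
      · rintro hP F ⟨-, Z, hZ, h⟩
        exact h P (hP Z hZ)
      · intro hP Z hZ
        obtain ⟨S, hS, rfl⟩ := hA hZ
        exact fun F hF => hP F ⟨hS F hF, _, hZ, fun Q hQ => hQ F hF⟩)
    (by
      rintro _ ⟨S, hS, rfl⟩ _ ⟨T, hT, rfl⟩
      refine ⟨{H | ∃ F ∈ S, ∃ G ∈ T, H = F * G}, ?_, ?_⟩
      · rintro _ ⟨F, hF, G, hG, rfl⟩
        obtain ⟨m, hm⟩ := hS F hF
        obtain ⟨n, hn⟩ := hT G hG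
        exact ⟨m + n, hm.mul hn⟩
      · ext P
        constructor
        · rintro (h | h) _ ⟨F, hF, G, hG, rfl⟩
          · have := h F hF
            simp_all [VanishesAt]
          · have := h G hG
            simp_all [VanishesAt]
        · intro h
          by_contra hP
          simp only [Set.mem_union, not_or, zeroLocus, Set.mem_ofPred_eq, not_forall] at hP
          obtain ⟨⟨F, hF, hF'⟩, G, hG, hG'⟩ := hP
          have := h _ ⟨F, hF, G, hG, rfl⟩
          simp_all [VanishesAt])

/-- An irreducible plane curve: the zero locus of an irreducible form. -/
def IsIrreducibleCurve (V : Set P2) : Prop :=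
  ∃ F : MvPolynomial (Fin 3) ℂ, IsForm F ∧ Irreducible F ∧ V = {P | VanishesAt F P}

/-- The group of complex points of the two-dimensional torus. -/
abbrev Gm2 : Type := ℂˣ × ℂˣ

/-- The open immersion `(x, y) ↦ [1 : x : y]` of the torus in the projective plane. -/
def toP2 (x : Gm2) : P2 :=
  Projectivization.mk ℂ ![1, (x.1 : ℂ), (x.2 : ℂ)] (fun h => one_ne_zero (congrFun h 0))

/-- The Zariski topology of the torus, as an open subset of the projective plane. -/
abbrev zariskiGm2 : TopologicalSpace Gm2 := zariski.induced toP2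

/-- A subtorus: a connected algebraic (that is, Zariski closed) subgroup. -/
def IsSubtorus (H : Subgroup Gm2) : Prop :=
  IsClosed[zariskiGm2] (H : Set Gm2) ∧ @IsConnected Gm2 zariskiGm2 (H : Set Gm2)

end PlaneTorus

end

/-! The proof compares two bounds on the Galois conjugates of a torsion point `P` of large order `N`
on the curve `F = 0`, with `F` of degree `n`.

Since torsion points have algebraic coordinates, `F` may be taken over a number field `K` of degree
`D` (`exists_algebraic_form`). Then at least `φ(N) / D` conjugates of `P` lie on the curve
(`exists_conjugates`). By the box principle (`exists_small_relation`), `P` satisfies some nontrivial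
`x ^ a₀ * y ^ b₀ = 1` with exponents at most `√N`, and so do its conjugates. This subgroup is a
union of `g = gcd(a₀, b₀)` torsion cosets of a one-dimensional subtorus. A coset not contained in
the curve meets it in at most `2n(|a₀| + |b₀|)/g` points (`param_zeros`). If no coset were contained
in the curve, there would thus be at most `4n√N` conjugates, whereas `φ(N)` is at least of order `N
^ (3/4)` (`Nat.cube_le_totient_pow_four`). So for large `N` the curve contains a torsion coset.

An irreducible form divides every form with which it has infinitely many common zeros on the torus
(`dvd_of_infinite`). Hence `F` divides the binomial form of the coset, as well as every form
vanishing on the coset, which gives both descriptions of the curve. -/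

namespace Polynomial

/-! ### Elimination of a variable -/

/-- Over a unique factorization domain, an irreducible polynomial and one it does not divide
generate an ideal that contains a nonzero constant, if the first has positive degree. -/
theorem exists_C_eq_of_irreducible_of_not_dvd {R : Type*} [CommRing R] [IsDomain R]
    [UniqueFactorizationMonoid R] {p q : Polynomial R} (hp : Irreducible p)
    (hdeg : p.natDegree ≠ 0) (hpq : ¬ p ∣ q) :
    ∃ r : R, r ≠ 0 ∧ ∃ a b : Polynomial R, a * p + b * q = C r := by
  classical
  let _ : NormalizedGCDMonoid R := Classical.choice inferInstance
  let K := FractionRing R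
  -- Gauss's lemma: `p` stays irreducible over the fraction field, and a quotient of `q` by `p`
  -- there would already have coefficients in `R`. So there is a Bézout identity over the field,
  -- whose denominators are then cleared.
  have hprim : p.IsPrimitive := hp.isPrimitive hdeg
  have hirr : Irreducible (p.map (algebraMap R K)) :=
    hprim.irreducible_iff_irreducible_map_fraction_map.mp hp
  have hnd : ¬ p.map (algebraMap R K) ∣ q.map (algebraMap R K) := by
    rintro ⟨g, hg⟩
    have h1 : p.map (algebraMap R K) * g ∈ lifts (algebraMap R K) := by
      rw [← hg]
      exact ⟨q, rfl⟩
    obtain ⟨g', hg'⟩ := hprim.map_mul_mem_lifts_iff.mp h1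
    refine hpq ⟨g', map_injective _ (IsFractionRing.injective R K) ?_⟩
    rw [hg, Polynomial.map_mul, ← hg']
    rfl
  obtain ⟨a, b, hab⟩ := (hirr.coprime_iff_not_dvd).mpr hnd
  obtain ⟨c, hc0, hc⟩ := IsLocalization.integerNormalization_spec (nonZeroDivisors R) a
  obtain ⟨d, hd0, hd⟩ := IsLocalization.integerNormalization_spec (nonZeroDivisors R) b
  refine ⟨c * d, nonZeroDivisors.ne_zero (mul_mem hc0 hd0),
    C d * IsLocalization.integerNormalization (nonZeroDivisors R) a,
    C c * IsLocalization.integerNormalization (nonZeroDivisors R) b,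
    map_injective _ (IsFractionRing.injective R K) ?_⟩
  simp only [Polynomial.map_add, Polynomial.map_mul, hc, hd, map_C, map_mul, Algebra.smul_def,
    algebraMap_apply, IsScalarTower.algebraMap_apply R K K[X]]
  linear_combination (C (algebraMap R K c) * C (algebraMap R K d)) * hab

end Polynomial

namespace MvPolynomial

/-- The common zeros of an irreducible polynomial and one it does not divide project to a proper
closed subset along the first coordinate. -/
theorem exists_ne_zero_eval_tail {k : Type*} [Field k] {n : ℕ}
    {F G : MvPolynomial (Fin (n + 1)) k} (hF : Irreducible F) (hFG : ¬ F ∣ G) :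
    ∃ r : MvPolynomial (Fin n) k, r ≠ 0 ∧ ∀ v : Fin (n + 1) → k,
      eval v F = 0 → eval v G = 0 → eval (fun i => v i.succ) r = 0 := by
  have key (H : MvPolynomial (Fin (n + 1)) k) (v : Fin (n + 1) → k) :
      eval v H = Polynomial.eval (v 0)
        ((finSuccEquiv k n H).map (eval fun i => v i.succ)) := by
    rw [← eval_eq_eval_mv_eval']
    congr 2
    exact (Fin.cons_self_tail v).symm
  have hF' : Irreducible (finSuccEquiv k n F) := (MulEquiv.irreducible_iff _).mpr hF
  -- If the first variable does not occur in `F`, then `F` itself serves as `r`.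
  by_cases hdeg : (finSuccEquiv k n F).natDegree = 0
  · obtain ⟨r, hr⟩ := Polynomial.natDegree_eq_zero.mp hdeg
    refine ⟨r, ?_, fun v hv _ => ?_⟩
    · rintro rfl
      rw [← hr, map_zero] at hF'
      exact hF'.ne_zero rfl
    · rw [key, ← hr] at hv
      simpa using hv
  · have hFG' : ¬ finSuccEquiv k n F ∣ finSuccEquiv k n G := by
      rwa [map_dvd_iff]
    obtain ⟨r, hr, a, b, h⟩ := Polynomial.exists_C_eq_of_irreducible_of_not_dvd hF' hdeg hFG'
    refine ⟨r, hr, fun v hv hw => ?_⟩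
    rw [key] at hv hw
    have := congrArg (fun p => Polynomial.eval (v 0) (p.map (eval fun i => v i.succ))) h
    simpa [hv, hw] using this.symm

/-- Renaming the variables allows the coordinate `σ 0` to be eliminated in place of the first one.
-/
theorem exists_ne_zero_eval_perm {k : Type*} [Field k] {n : ℕ}
    {F G : MvPolynomial (Fin (n + 1)) k} (hF : Irreducible F) (hFG : ¬ F ∣ G)
    (σ : Equiv.Perm (Fin (n + 1))) :
    ∃ r : MvPolynomial (Fin n) k, r ≠ 0 ∧ ∀ v : Fin (n + 1) → k,
      eval v F = 0 → eval v G = 0 → eval (fun i => v (σ i.succ)) r = 0 := by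
  have h1 : Irreducible (renameEquiv k σ.symm F) := (MulEquiv.irreducible_iff _).mpr hF
  have h2 : ¬ renameEquiv k σ.symm F ∣ renameEquiv k σ.symm G := by rwa [map_dvd_iff]
  obtain ⟨r, hr, h⟩ := exists_ne_zero_eval_tail h1 h2
  have hv (v : Fin (n + 1) → k) : (v ∘ σ) ∘ σ.symm = v := by
    ext i
    simp
  refine ⟨r, hr, fun v hvF hvG => h (v ∘ σ) ?_ ?_⟩
  · rwa [renameEquiv_apply, eval_rename, hv]
  · rwa [renameEquiv_apply, eval_rename, hv]

/-- A polynomial in two variables that vanishes on infinitely many lines through the origin is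
zero. -/
theorem eq_zero_of_infinite_lines {k : Type*} [Field k] [Infinite k]
    {r : MvPolynomial (Fin 2) k} {T : Set k} (hT : T.Infinite)
    (h : ∀ x ∈ T, ∀ s : k, eval ![s * x, s] r = 0) : r = 0 := by
  -- This substitution turns the lines into the product set `T × k`, on which a nonzero polynomial
  -- cannot vanish. It is invertible where the second coordinate is nonzero, which recovers `r = 0`.
  let q : MvPolynomial (Fin 2) k := bind₁ ![X 1 * X 0, X 1] r
  have hq (v : Fin 2 → k) : eval v q = eval ![v 1 * v 0, v 1] r := by
    rw [← coe_aeval_eq_eval, ← coe_aeval_eq_eval]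
    simp only [q, RingHom.coe_coe, aeval_bind₁]
    congr 2
    ext i
    fin_cases i <;> simp
  have hq0 : q = 0 := by
    refine MvPolynomial.funext_set ![T, Set.univ] (fun i => ?_) fun v hv => ?_
    · fin_cases i
      · exact hT
      · exact Set.infinite_univ
    rw [hq, map_zero]
    exact h _ (hv 0 trivial) _
  refine MvPolynomial.funext_set (fun _ => {0}ᶜ)
    (fun _ => (Set.finite_singleton (0 : k)).infinite_compl) fun v hv => ?_
  have hv1 : v 1 ≠ 0 := hv 1 trivial
  have h2 := hq ![v 0 / v 1, v 1]
  rw [hq0, map_zero] at h2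
  rw [map_zero, h2]
  congr 2
  ext i
  fin_cases i
  · simp [mul_div_cancel₀ _ hv1]
  · simp

end MvPolynomial

namespace MvPolynomial

theorem IsHomogeneous.eval_smul {R σ : Type*} [CommSemiring R] {F : MvPolynomial σ R} {n : ℕ}
    (hF : F.IsHomogeneous n) (s : R) (v : σ → R) : eval (s • v) F = s ^ n * eval v F := by
  rw [eval_eq, eval_eq, Finset.mul_sum]
  refine Finset.sum_congr rfl fun d hd => ?_
  have hd' : ∑ i ∈ d.support, d i = n := by
    have h1 := hF (mem_support_iff.mp hd)
    simpa [Finsupp.weight_apply, Finsupp.sum] using h1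
  simp only [Pi.smul_apply, smul_eq_mul, mul_pow, Finset.prod_mul_distrib,
    Finset.prod_pow_eq_pow_sum, hd']
  ring

end MvPolynomial

/-! ### Common zeros of forms on the torus -/

namespace PlaneTorus

open MvPolynomial

/-- The homogeneous coordinates of a point of the torus. -/
def coords (x : Gm2) : Fin 3 → ℂ := ![1, (x.1 : ℂ), (x.2 : ℂ)]

theorem vanishesAt_toP2 {F : MvPolynomial (Fin 3) ℂ} (hF : IsForm F) (x : Gm2) :
    VanishesAt F (toP2 x) ↔ eval (coords x) F = 0 :=
  vanishesAt_mk hF.choose_spec _ _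

/-- Two forms, the first irreducible, with infinitely many common zeros on the torus. -/
theorem dvd_of_infinite {F G : MvPolynomial (Fin 3) ℂ} (hF : IsForm F) (hF' : Irreducible F)
    (hG : IsForm G)
    (h : {x : Gm2 | eval (coords x) F = 0 ∧ eval (coords x) G = 0}.Infinite) : F ∣ G := by
  by_contra hFG
  set Z := {x : Gm2 | eval (coords x) F = 0 ∧ eval (coords x) G = 0} with hZ
  obtain ⟨n, hn⟩ := hF
  obtain ⟨m, hm⟩ := hG
  -- either coordinate takes only finitely many values on `Z`
  have aux (c : Gm2 → ℂˣ) (σ : Equiv.Perm (Fin 3))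
      (hσ : ∀ (x : Gm2) (s : ℂ), (fun i : Fin 2 => (s • coords x) (σ i.succ)) = ![s * c x, s]) :
      (c '' Z).Finite := by
    by_contra hinf
    obtain ⟨r, hr, hrv⟩ := exists_ne_zero_eval_perm hF' hFG σ
    have hinf' : ((fun u : ℂˣ => (u : ℂ)) '' (c '' Z)).Infinite :=
      Set.Infinite.image Units.val_injective.injOn hinf
    refine hr (eq_zero_of_infinite_lines hinf' ?_)
    rintro _ ⟨_, ⟨x, hx, rfl⟩, rfl⟩ s
    -- By homogeneity both forms vanish on the whole line through `coords x`.
    have h1 := hrv (s • coords x) (by rw [hn.eval_smul, hx.1, mul_zero])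
      (by rw [hm.eval_smul, hx.2, mul_zero])
    rwa [hσ] at h1
  -- The swap eliminates `X₂` and keeps `(X₁, X₀)`; the rotation used for the second coordinate
  -- eliminates `X₁` and keeps `(X₂, X₀)`.
  have h1 : (Prod.fst '' Z).Finite := aux Prod.fst (Equiv.swap 0 2) fun x s => by
    ext i
    fin_cases i
    · simp [coords, show Equiv.swap (0 : Fin 3) 2 1 = 1 by decide]
    · simp [coords, show Equiv.swap (0 : Fin 3) 2 2 = 0 by decide]
  have h2 : (Prod.snd '' Z).Finite := aux Prod.snd (finRotate 3) fun x s => by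
    ext i
    fin_cases i
    · simp [coords, show finRotate 3 1 = 2 by decide]
    · simp [coords, show finRotate 3 2 = 0 by decide]
  exact h ((h1.prod h2).subset fun x hx => ⟨⟨x, hx, rfl⟩, ⟨x, hx, rfl⟩⟩)

/-! ### Cosets of one-dimensional subtori -/

/-- The form `X₀ ^ A * X₁ ^ a⁺ * X₂ ^ b⁺ - u * X₀ ^ B * X₁ ^ a⁻ * X₂ ^ b⁻`, whose zeros on the
torus are the solutions of `x ^ a * y ^ b = u`. -/
noncomputable def binomialForm (a b : ℤ) (u : ℂˣ) : MvPolynomial (Fin 3) ℂ :=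
  X 0 ^ ((-a).toNat + (-b).toNat) * (X 1 ^ a.toNat * X 2 ^ b.toNat) -
    C (u : ℂ) * (X 0 ^ (a.toNat + b.toNat) * (X 1 ^ (-a).toNat * X 2 ^ (-b).toNat))

theorem isForm_binomialForm (a b : ℤ) (u : ℂˣ) : IsForm (binomialForm a b u) := by
  refine ⟨((-a).toNat + (-b).toNat) + (a.toNat + b.toNat), .sub ?_ ?_⟩
  · exact (isHomogeneous_X_pow (R := ℂ) _ _).mul ((isHomogeneous_X_pow (R := ℂ) _ _).mul (isHomogeneous_X_pow (R := ℂ) _ _))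
  · rw [add_comm ((-a).toNat + (-b).toNat)]
    exact ((isHomogeneous_X_pow (R := ℂ) _ _).mul
      ((isHomogeneous_X_pow (R := ℂ) _ _).mul (isHomogeneous_X_pow (R := ℂ) _ _))).C_mul _

theorem eval_binomialForm (a b : ℤ) (u : ℂˣ) (x : Gm2) :
    eval (coords x) (binomialForm a b u) = 0 ↔ x.1 ^ a * x.2 ^ b = u := by
  have h (c : ℤ) (z : ℂˣ) : z ^ c = z ^ c.toNat * (z ^ (-c).toNat)⁻¹ := by
    rw [← zpow_natCast, ← zpow_natCast, ← zpow_neg, ← zpow_add]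
    congr 1
    omega
  have h' : x.1 ^ a * x.2 ^ b = u ↔ x.1 ^ a.toNat * x.2 ^ b.toNat =
      u * (x.1 ^ (-a).toNat * x.2 ^ (-b).toNat) := by
    rw [h a, h b, mul_mul_mul_comm, ← mul_inv, mul_inv_eq_iff_eq_mul]
  rw [h', ← Units.val_inj]
  simp [binomialForm, coords, sub_eq_zero]

/-- The one-parameter subgroups `t ↦ (w ^ p * t ^ (-b), w ^ q * t ^ a)`, translated. -/
def param (a b p q : ℤ) (w t : ℂˣ) : Gm2 := (w ^ p * t ^ (-b), w ^ q * t ^ a)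

/-- The exponent matrix of `(w, t) ↦ param a b p q w t` has determinant `p * a + q * b = 1`, so this
map is an automorphism of the torus with inverse `(x ^ a * y ^ b, x ^ (-q) * y ^ p)`. -/
theorem param_pow {a b p q : ℤ} (h : p * a + q * b = 1) (w t : ℂˣ) :
    (param a b p q w t).1 ^ a * (param a b p q w t).2 ^ b = w := by
  simp only [param, mul_zpow, ← zpow_mul]
  rw [mul_mul_mul_comm, ← zpow_add, ← zpow_add, h]
  simp [mul_comm a b]

theorem param_inv {a b p q : ℤ} (h : p * a + q * b = 1) (w t : ℂˣ) :
    (param a b p q w t).1 ^ (-q) * (param a b p q w t).2 ^ p = t := by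
  simp only [param, mul_zpow, ← zpow_mul]
  rw [mul_mul_mul_comm, ← zpow_add, ← zpow_add,
    show -b * -q + a * p = 1 by linear_combination h, show p * -q + q * p = 0 by ring]
  simp

theorem eq_param {a b p q : ℤ} (h : p * a + q * b = 1) (x : Gm2) :
    x = param a b p q (x.1 ^ a * x.2 ^ b) (x.1 ^ (-q) * x.2 ^ p) := by
  ext1
  · simp only [param, mul_zpow, ← zpow_mul]
    rw [mul_mul_mul_comm, ← zpow_add, ← zpow_add,
      show a * p + -q * -b = 1 by linear_combination h, show b * p + p * -b = 0 by ring]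
    simp
  · simp only [param, mul_zpow, ← zpow_mul]
    rw [mul_mul_mul_comm, ← zpow_add, ← zpow_add,
      show b * q + p * a = 1 by linear_combination h, show a * q + -q * a = 0 by ring]
    simp

theorem param_injective {a b p q : ℤ} (h : p * a + q * b = 1) (w : ℂˣ) :
    Function.Injective (param a b p q w) := by
  intro s t hst
  rw [← param_inv h w s, hst, param_inv h]

/-- The restriction of a form of degree `n` to a translated one-parameter subgroup has at most
`2 * n * (|a| + |b|)` zeros, or it is zero. -/
theorem param_zeros {F : MvPolynomial (Fin 3) ℂ} {n : ℕ} (hF : F.IsHomogeneous n)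
    (a b p q : ℤ) (w : ℂˣ) :
    (∀ t, eval (coords (param a b p q w t)) F = 0) ∨
      ({t | eval (coords (param a b p q w t)) F = 0}.Finite ∧
       {t | eval (coords (param a b p q w t)) F = 0}.ncard ≤ n * (2 * (a.natAbs + b.natAbs))) := by
  -- Scaling the coordinates by `t ^ B` clears the negative powers of `t`: the exponents `B`, `B -
  -- b`, `B + a` all lie between `0` and `2 * B`.
  set B := a.natAbs + b.natAbs with hB
  let f : Fin 3 → Polynomial ℂ := ![Polynomial.X ^ B,
    Polynomial.C ((w ^ p : ℂˣ) : ℂ) * Polynomial.X ^ (B - b).toNat,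
    Polynomial.C ((w ^ q : ℂˣ) : ℂ) * Polynomial.X ^ (B + a).toNat]
  let P : Polynomial ℂ := aeval f F
  have hf (t : ℂˣ) : (fun i => (f i).eval (t : ℂ)) =
      ((t : ℂ) ^ B) • coords (param a b p q w t) := by
    ext i
    fin_cases i
    · simp [f, coords]
    · have : (t : ℂˣ) ^ (B - b).toNat = t ^ B * t ^ (-b) := by
        rw [← zpow_natCast, ← zpow_natCast, ← zpow_add]
        congr 1
        omega
      have := congrArg (fun z : ℂˣ => (z : ℂ)) this
      simp only [Units.val_mul, Units.val_pow_eq_pow_val] at this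
      simp only [f, coords, param, Fin.mk_one, Matrix.cons_val_one, Matrix.cons_val_zero,
        Polynomial.eval_mul, Polynomial.eval_C, Polynomial.eval_pow, Polynomial.eval_X,
        Pi.smul_apply, smul_eq_mul, Units.val_mul, this]
      ring
    · have : (t : ℂˣ) ^ (B + a).toNat = t ^ B * t ^ a := by
        rw [← zpow_natCast, ← zpow_natCast, ← zpow_add]
        congr 1
        omega
      have := congrArg (fun z : ℂˣ => (z : ℂ)) this
      simp only [Units.val_mul, Units.val_pow_eq_pow_val] at this
      simp only [f, coords, param, Fin.reduceFinMk, Matrix.cons_val,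
        Polynomial.eval_mul, Polynomial.eval_C, Polynomial.eval_pow, Polynomial.eval_X,
        Pi.smul_apply, smul_eq_mul, Units.val_mul, this]
      ring
  have hP (t : ℂˣ) : P.eval (t : ℂ) =
      ((t : ℂ) ^ B) ^ n * eval (coords (param a b p q w t)) F := by
    rw [← hF.eval_smul, ← hf, ← Polynomial.coe_evalRingHom]
    simp only [P, aeval_def, hom_eval₂, eval, coe_eval₂Hom]
    congr 1
    ext
    simp
  have hroot (t : ℂˣ) : eval (coords (param a b p q w t)) F = 0 ↔ P.eval (t : ℂ) = 0 := by
    rw [hP]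
    simp
  have hdeg : P.natDegree ≤ n * (2 * B) := by
    simp only [P, aeval_def, eval₂_eq, Polynomial.algebraMap_eq]
    refine Polynomial.natDegree_sum_le_of_forall_le _ _ fun d hd => ?_
    have hd' : ∑ i ∈ d.support, d i = n := by
      have h1 := hF (mem_support_iff.mp hd)
      simpa [Finsupp.weight_apply, Finsupp.sum] using h1
    have hfi (i : Fin 3) : (f i).natDegree ≤ 2 * B := by
      fin_cases i
      · simp only [f]
        simp
        omega
      · refine (Polynomial.natDegree_C_mul_X_pow_le _ _).trans ?_
        omega
      · refine (Polynomial.natDegree_C_mul_X_pow_le _ _).trans ?_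
        omega
    refine (Polynomial.natDegree_C_mul_le _ _).trans ?_
    refine (Polynomial.natDegree_prod_le _ _).trans ?_
    rw [← hd', Finset.sum_mul]
    refine Finset.sum_le_sum fun i _ => ?_
    exact Polynomial.natDegree_pow_le.trans (Nat.mul_le_mul_left _ (hfi i))
  by_cases hP0 : P = 0
  · exact Or.inl fun t => by rw [hroot, hP0, Polynomial.eval_zero]
  · right
    have hsub : (fun t : ℂˣ => (t : ℂ)) '' {t | eval (coords (param a b p q w t)) F = 0} ⊆
        (P.roots.toFinset : Set ℂ) := by
      rintro _ ⟨t, ht, rfl⟩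
      simpa [hP0] using (hroot t).mp ht
    refine ⟨Set.Finite.of_finite_image ((Finset.finite_toSet _).subset hsub)
      Units.val_injective.injOn, ?_⟩
    rw [← Set.ncard_image_of_injective _ Units.val_injective]
    refine (Set.ncard_le_ncard hsub (Finset.finite_toSet _)).trans ?_
    rw [Set.ncard_coe_finset]
    exact (Multiset.toFinset_card_le _).trans ((Polynomial.card_roots' _).trans hdeg)

end PlaneTorus

/-! ### Totient bound and box principle -/

/-- Local factors of a multiplicative inequality. Since `p ^ 3 ≤ (p - 1) ^ 4` for `p ≥ 4`, only `2`
and `3` need a constant (`8 ≤ 8 * 1` and `27 ≤ 2 * 16`), and the product of these constants is `16`.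
-/
theorem Nat.pow_three_le_totient_pow_four {p e : ℕ} (hp : p.Prime) (he : 0 < e) :
    (p ^ e) ^ 3 ≤ (if p = 2 then 8 else if p = 3 then 2 else 1) * (p ^ e).totient ^ 4 := by
  obtain ⟨e, rfl⟩ : ∃ k, e = k + 1 := ⟨e - 1, by omega⟩
  rw [Nat.totient_prime_pow_succ hp]
  have h1 : (p ^ e) ^ 3 ≤ (p ^ e) ^ 4 := Nat.pow_le_pow_right (Nat.pow_pos hp.pos) (by norm_num)
  have h2 : p ^ 3 ≤ (if p = 2 then 8 else if p = 3 then 2 else 1) * (p - 1) ^ 4 := by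
    split_ifs with h2 h3
    · subst h2; norm_num
    · subst h3; norm_num
    · have h5 : 4 ≤ p := by
        have := hp.two_le
        omega
      obtain ⟨k, rfl⟩ : ∃ k, p = k + 4 := ⟨p - 4, by omega⟩
      rw [one_mul, show k + 4 - 1 = k + 3 by omega]
      nlinarith [sq_nonneg (k * k), Nat.zero_le (k ^ 3), Nat.zero_le (k ^ 4), Nat.zero_le (k ^ 2)]
  calc (p ^ (e + 1)) ^ 3 = (p ^ e) ^ 3 * p ^ 3 := by rw [pow_succ p e, mul_pow]
    _ ≤ (p ^ e) ^ 4 * ((if p = 2 then 8 else if p = 3 then 2 else 1) * (p - 1) ^ 4) :=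
        Nat.mul_le_mul h1 h2
    _ = _ := by rw [mul_pow]; ring

/-- A lower bound for the totient function. -/
theorem Nat.cube_le_totient_pow_four {n : ℕ} (hn : n ≠ 0) : n ^ 3 ≤ 16 * n.totient ^ 4 := by
  suffices h : n ^ 3 ≤ (∏ p ∈ n.primeFactors, if p = 2 then 8 else if p = 3 then 2 else 1) *
      n.totient ^ 4 by
    refine h.trans (Nat.mul_le_mul_right _ ?_)
    have : ∀ S : Finset ℕ,
        (∏ p ∈ S, if p = 2 then 8 else if p = 3 then 2 else 1) ∣ 16 := fun S => by
      have hS : ∀ p ∈ S, (if p = 2 then 8 else if p = 3 then 2 else 1) =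
          (if p = 2 then 8 else 1) * (if p = 3 then 2 else 1) := fun p _ => by
        split_ifs <;> simp_all
      rw [Finset.prod_congr rfl hS, Finset.prod_mul_distrib, Finset.prod_ite_eq',
        Finset.prod_ite_eq']
      split_ifs <;> norm_num
    exact Nat.le_of_dvd (by norm_num) (this _)
  induction n using Nat.recOnPosPrimePosCoprime with
  | zero => exact absurd rfl hn
  | one => simp
  | prime_pow p e hp he =>
    rw [Nat.primeFactors_prime_pow he.ne' hp, Finset.prod_singleton]
    exact Nat.pow_three_le_totient_pow_four hp he
  | coprime a b ha hb hab iha ihb =>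
    rw [hab.primeFactors_mul, Finset.prod_union hab.disjoint_primeFactors,
      Nat.totient_mul hab, mul_pow, mul_pow]
    refine (Nat.mul_le_mul (iha (by omega)) (ihb (by omega))).trans (le_of_eq ?_)
    ring

/-- A form of Dirichlet's box principle: two elements of the `N`-th roots of unity satisfy a
multiplicative relation with exponents of absolute value at most `√N`. -/
theorem exists_small_relation {N : ℕ} (hN : N ≠ 0) {x y : ℂˣ} (hx : x ^ N = 1) (hy : y ^ N = 1) :
    ∃ a b : ℤ, (a ≠ 0 ∨ b ≠ 0) ∧ a.natAbs ≤ N.sqrt ∧ b.natAbs ≤ N.sqrt ∧ x ^ a * y ^ b = 1 := by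
  have : NeZero N := ⟨hN⟩
  -- There are `(√N + 1) ^ 2 > N` exponent pairs, but at most `N` values, all of them `N`-th roots
  -- of unity.
  let s := Finset.range (N.sqrt + 1) ×ˢ Finset.range (N.sqrt + 1)
  have hfin : Finite (rootsOfUnity N ℂ) := inferInstance
  let T : Finset ℂˣ := (Set.toFinite (rootsOfUnity N ℂ : Set ℂˣ)).toFinset
  have hT : T.card ≤ N := by
    rw [← Set.ncard_eq_toFinset_card _ (Set.toFinite _), ← Nat.card_coe_set_eq]
    exact card_rootsOfUnity ℂ N
  have hlt : T.card < s.card := by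
    rw [Finset.card_product, Finset.card_range]
    exact hT.trans_lt (Nat.lt_succ_sqrt N)
  obtain ⟨⟨i, j⟩, hij, ⟨k, l⟩, hkl, hne, heq⟩ :=
    Finset.exists_ne_map_eq_of_card_lt_of_maps_to (s := s) (t := T) hlt
      (f := fun ij => x ^ ij.1 * y ^ ij.2) (by
        rintro ⟨i, j⟩ -
        rw [Set.Finite.coe_toFinset, SetLike.mem_coe, mem_rootsOfUnity]
        rw [mul_pow, ← pow_mul, ← pow_mul, mul_comm i, mul_comm j, pow_mul, pow_mul, hx, hy]
        simp)
  simp only [s, Finset.mem_product, Finset.mem_range] at hij hkl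
  refine ⟨i - k, j - l, ?_, by omega, by omega, ?_⟩
  · by_contra! h
    exact hne (Prod.ext (by omega) (by omega))
  · simp only at heq
    rw [zpow_sub, zpow_sub]
    simp only [zpow_natCast]
    rw [mul_mul_mul_comm, heq, ← mul_inv, mul_inv_cancel]

/-! ### Galois conjugates and field of definition -/

namespace PlaneTorus

open MvPolynomial

/-- The coordinates of a point of order `N` are powers of a primitive `N`-th root of unity, and
these exponents separate the `N`-th roots of unity. -/
theorem exists_exponents {P : Gm2} {N : ℕ} (hN : N ≠ 0) (hP : orderOf P = N) {ζ : ℂˣ}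
    (hζ : IsPrimitiveRoot ζ N) :
    ∃ m n : ℕ, P = (ζ ^ m, ζ ^ n) ∧
      ∀ z z' : ℂˣ, z ^ N = 1 → z' ^ N = 1 → z ^ m = z' ^ m → z ^ n = z' ^ n → z = z' := by
  have hPN : P ^ N = 1 := hP ▸ pow_orderOf_eq_one P
  have : NeZero N := ⟨hN⟩
  have hroot (z : ℂˣ) (hz : z ^ N = 1) : ∃ m : ℕ, ζ ^ m = z := by
    obtain ⟨m, -, hm⟩ := (IsPrimitiveRoot.coe_units_iff.mpr hζ).eq_pow_of_pow_eq_one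
      (ξ := (z : ℂ)) (by rw [← Units.val_pow_eq_pow_val, hz, Units.val_one])
    exact ⟨m, Units.ext (by simpa using hm)⟩
  obtain ⟨m, hm⟩ := hroot P.1 (congrArg Prod.fst hPN)
  obtain ⟨n, hn⟩ := hroot P.2 (congrArg Prod.snd hPN)
  refine ⟨m, n, Prod.ext hm.symm hn.symm, fun z z' hz hz' h1 h2 => ?_⟩
  -- The order `d` of `w` divides `N`, `m` and `n`. With `N = d * k` this gives `P ^ k = 1`, so `N ∣
  -- k` and `d = 1`.
  set w := z / z' with hw
  have hwN : w ^ N = 1 := by rw [hw, div_pow, hz, hz', div_one]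
  have hwm : w ^ m = 1 := by rw [hw, div_pow, h1, div_self']
  have hwn : w ^ n = 1 := by rw [hw, div_pow, h2, div_self']
  obtain ⟨k, hk⟩ := orderOf_dvd_of_pow_eq_one hwN
  obtain ⟨m', hm'⟩ := orderOf_dvd_of_pow_eq_one hwm
  obtain ⟨n', hn'⟩ := orderOf_dvd_of_pow_eq_one hwn
  have hPk : P ^ k = 1 := by
    have hζN := hζ.pow_eq_one
    refine Prod.ext ?_ ?_
    · rw [Prod.pow_fst, ← hm, ← pow_mul, hm', mul_right_comm, ← hk, pow_mul, hζN, one_pow]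
      rfl
    · rw [Prod.pow_snd, ← hn, ← pow_mul, hn', mul_right_comm, ← hk, pow_mul, hζN, one_pow]
      rfl
  have hdvd : N ∣ k := hP ▸ orderOf_dvd_of_pow_eq_one hPk
  have hk0 : 0 < k := Nat.pos_of_ne_zero (by rintro rfl; exact hN (by simpa using hk))
  have : orderOf w = 1 := by
    have h3 : orderOf w * k ≤ k := hk ▸ Nat.le_of_dvd hk0 hdvd
    have h4 : 0 < orderOf w := Nat.pos_of_ne_zero (by
      intro h
      rw [h, zero_mul] at hk
      exact hN hk)
    nlinarith
  rw [orderOf_eq_one_iff, hw, div_eq_one] at this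
  exact this

/-- The degree of a primitive `N`-th root of unity over a number field `K`. -/
theorem totient_le_finrank_mul_natDegree {K : IntermediateField ℚ ℂ} [FiniteDimensional ℚ K]
    {N : ℕ} (hN : 0 < N) {ζ : ℂ} (hζ : IsPrimitiveRoot ζ N) :
    N.totient ≤ Module.finrank ℚ K * (minpoly K ζ).natDegree := by
  have hint : IsIntegral ℚ ζ := (hζ.isIntegral hN).tower_top
  have hintK : IsIntegral K ζ := hint.tower_top
  have : FiniteDimensional K (IntermediateField.adjoin K {ζ}) :=
    IntermediateField.adjoin.finiteDimensional hintK
  have : FiniteDimensional ℚ (IntermediateField.adjoin K {ζ}) := FiniteDimensional.trans ℚ K _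
  -- `φ(N) = [ℚ(ζ) : ℚ] ≤ [K(ζ) : ℚ] = [K : ℚ] * [K(ζ) : K]`.
  rw [← IntermediateField.adjoin.finrank hintK, Module.finrank_mul_finrank,
    ← Polynomial.natDegree_cyclotomic N ℚ, Polynomial.cyclotomic_eq_minpoly_rat hζ hN]
  have := minpoly.natDegree_le (A := ℚ) (IntermediateField.AdjoinSimple.gen K ζ)
  rwa [← minpoly.algebraMap_eq (B' := ℂ)
    (algebraMap (IntermediateField.adjoin K {ζ}) ℂ).injective,
    IntermediateField.AdjoinSimple.algebraMap_gen] at this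

/-- A torsion point of order `N` on a curve over a number field `K` has at least
`φ(N) / [K : ℚ]` conjugates on the curve. -/
theorem exists_conjugates {K : IntermediateField ℚ ℂ} [FiniteDimensional ℚ K]
    {F : MvPolynomial (Fin 3) ℂ} (hFK : ∀ d, F.coeff d ∈ K)
    {P : Gm2} {N : ℕ} (hN : N ≠ 0) (hP : orderOf P = N) (hPF : eval (coords P) F = 0) :
    ∃ S : Finset Gm2, N.totient ≤ Module.finrank ℚ K * S.card ∧
      ∀ Q ∈ S, eval (coords Q) F = 0 ∧
        ∀ a b : ℤ, P.1 ^ a * P.2 ^ b = 1 → Q.1 ^ a * Q.2 ^ b = 1 := by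
  classical
  have : NeZero N := ⟨hN⟩
  set ζ₀ : ℂ := Complex.exp (2 * Real.pi * Complex.I / N) with hζ₀
  have hζ' : IsPrimitiveRoot ζ₀ N := Complex.isPrimitiveRoot_exp N hN
  obtain ⟨ζ, hζ₀'⟩ : ∃ ζ : ℂˣ, (ζ : ℂ) = ζ₀ := (hζ'.isUnit hN)
  rw [← hζ₀'] at hζ'
  have hζ : IsPrimitiveRoot ζ N := IsPrimitiveRoot.coe_units_iff.mp hζ'
  obtain ⟨m, n, hmn, hinj⟩ := exists_exponents hN hP hζ
  have hint : IsIntegral K (ζ : ℂ) :=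
    ((hζ'.isIntegral (Nat.pos_of_ne_zero hN)).tower_top (A := ℚ)).tower_top
  obtain ⟨F', hF'⟩ : F ∈ Set.range (map (algebraMap K ℂ)) := by
    refine mem_range_map_iff_coeffs_subset.mpr fun c hc => ?_
    obtain ⟨d, -, rfl⟩ := mem_coeffs_iff.mp hc
    exact ⟨⟨_, hFK d⟩, rfl⟩
  -- Pulled back along `z ↦ (z ^ m, z ^ n)`, the equation of the curve is a polynomial over `K` with
  -- root `ζ`; it therefore vanishes at every conjugate of `ζ` over `K`.
  let f : Polynomial K := aeval ![1, Polynomial.X ^ m, Polynomial.X ^ n] F'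
  have hf (z : ℂˣ) : Polynomial.aeval (z : ℂ) f = eval (coords (z ^ m, z ^ n)) F := by
    rw [← hF', eval_map, ← aeval_def]
    simp only [f]
    rw [← AlgHom.comp_apply, comp_aeval]
    congr 2
    ext i
    fin_cases i <;> simp [coords]
  have hdvd : minpoly K (ζ : ℂ) ∣ f := minpoly.dvd _ _ (by rw [hf, ← hmn, hPF])
  have hdvdN : minpoly K (ζ : ℂ) ∣ Polynomial.X ^ N - 1 :=
    minpoly.dvd _ _ (by simp [hζ'.pow_eq_one])
  let R : Finset ℂ := ((minpoly K (ζ : ℂ)).aroots ℂ).toFinset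
  have hR : R.card = (minpoly K (ζ : ℂ)).natDegree := by
    rw [Multiset.toFinset_card_of_nodup
      (Polynomial.nodup_aroots_iff_of_splits (minpoly.ne_zero hint) (IsAlgClosed.splits _) |>.mpr
        (minpoly.irreducible hint).separable), Polynomial.aroots,
      ← (IsAlgClosed.splits _).natDegree_eq_card_roots, Polynomial.natDegree_map]
  have hRN : ∀ z ∈ R, z ^ N = 1 ∧ Polynomial.aeval z f = 0 := by
    intro z hz
    have hz0 : Polynomial.aeval z (minpoly K (ζ : ℂ)) = 0 :=
      (Polynomial.mem_aroots.mp (Multiset.mem_toFinset.mp hz)).2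
    obtain ⟨g, hg⟩ := hdvdN
    obtain ⟨g', hg'⟩ := hdvd
    have := congrArg (Polynomial.aeval z) hg
    rw [map_mul, hz0, zero_mul] at this
    refine ⟨by simpa [sub_eq_zero] using this, ?_⟩
    rw [hg', map_mul, hz0, zero_mul]
  let U : Finset ℂˣ := R.preimage _ Units.val_injective.injOn
  have hU : U.card = R.card := by
    rw [Finset.card_preimage, Finset.filter_true_of_mem]
    intro z hz
    exact ((IsUnit.of_pow_eq_one (hRN z hz).1 hN))
  refine ⟨U.image fun z => (z ^ m, z ^ n), ?_, ?_⟩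
  · rw [Finset.card_image_of_injOn, hU, hR]
    · exact totient_le_finrank_mul_natDegree (Nat.pos_of_ne_zero hN) hζ'
    · intro z hz z' hz' h
      refine hinj z z' (Units.ext ?_) (Units.ext ?_) (congrArg Prod.fst h) (congrArg Prod.snd h)
      · simpa using (hRN _ (Finset.mem_preimage.mp hz)).1
      · simpa using (hRN _ (Finset.mem_preimage.mp hz')).1
  · intro Q hQ
    obtain ⟨z, hz, rfl⟩ := Finset.mem_image.mp hQ
    have hz' := hRN _ (Finset.mem_preimage.mp hz)
    have hzN : z ^ N = 1 := Units.ext (by simpa using hz'.1)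
    refine ⟨by rw [← hf, hz'.2], fun a b hab => ?_⟩
    rw [hmn] at hab
    simp only [← zpow_natCast, ← zpow_mul, ← zpow_add] at hab ⊢
    -- A monomial relation at `P` says that `N` divides `m * a + n * b`, so it holds for every
    -- `N`-th root of unity `z`.
    obtain ⟨c, hc⟩ := (hζ.zpow_eq_one_iff_dvd _).mp hab
    rw [hc, zpow_mul, zpow_natCast, hzN, one_zpow]

/-- An irreducible form with infinitely many torsion points is proportional to one with algebraic
coefficients. -/
theorem exists_algebraic_form {F : MvPolynomial (Fin 3) ℂ} (hF : IsForm F) (hF' : Irreducible F)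
    (h : {x : Gm2 | IsOfFinOrder x ∧ eval (coords x) F = 0}.Infinite) :
    ∃ G : MvPolynomial (Fin 3) ℂ, IsForm G ∧ Associated F G ∧ ∀ d, IsAlgebraic ℚ (G.coeff d) := by
  obtain ⟨n, hn⟩ := hF
  let L := algebraicClosure ℚ ℂ
  obtain ⟨d₀, hd₀⟩ : ∃ d, F.coeff d ≠ 0 := by
    by_contra! h0
    exact hF'.ne_zero (MvPolynomial.ext _ _ (by simpa using h0))
  -- An `L`-linear functional `ℂ → L`, applied to the coefficients, commutes with evaluation at
  -- points with coordinates in `L`, in particular at torsion points. The choice of `φ` keeps the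
  -- resulting form nonzero.
  obtain ⟨φ, hφ⟩ : ∃ φ : Module.Dual L ℂ, φ (F.coeff d₀) ≠ 0 := by
    by_contra! h0
    exact hd₀ ((Module.forall_dual_apply_eq_zero_iff L _).mp h0)
  let G : MvPolynomial (Fin 3) ℂ := ∑ d ∈ F.support, monomial d ((φ (F.coeff d) : L) : ℂ)
  have hcoeff (d) : G.coeff d = ((φ (F.coeff d) : L) : ℂ) := by
    simp only [G, coeff_sum, coeff_monomial, Finset.sum_ite_eq']
    split_ifs with hd
    · rfl
    · rw [notMem_support_iff.mp hd, map_zero]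
      rfl
  have hG : G.IsHomogeneous n := IsHomogeneous.sum _ _ _ fun d hd =>
    isHomogeneous_monomial _ (hn.degree_eq_sum_deg_support hd).symm
  have hG0 : G ≠ 0 := by
    intro h0
    have := hcoeff d₀
    rw [h0, coeff_zero] at this
    exact hφ (Subtype.ext this.symm)
  have hdvd : F ∣ G := by
    refine dvd_of_infinite ⟨n, hn⟩ hF' ⟨n, hG⟩ (h.mono ?_)
    rintro x ⟨hx, hxF⟩
    refine ⟨hxF, ?_⟩
    have hxL (i : Fin 3) : coords x i ∈ L := by
      obtain ⟨N, hN, hxN⟩ := isOfFinOrder_iff_pow_eq_one.mp hx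
      have key (z : ℂˣ) (hz : z ^ N = 1) : (z : ℂ) ∈ L := by
        refine mem_algebraicClosure_iff.mpr (IsIntegral.isAlgebraic ?_)
        refine IsIntegral.of_pow hN ?_
        rw [← Units.val_pow_eq_pow_val, hz]
        exact isIntegral_one
      fin_cases i
      · exact one_mem L
      · exact key _ (congrArg Prod.fst hxN)
      · exact key _ (congrArg Prod.snd hxN)
    have hprod (d : Fin 3 →₀ ℕ) : ∃ l : L, ∏ i ∈ d.support, coords x i ^ d i = l :=
      ⟨⟨_, prod_mem fun i _ => pow_mem (hxL i) _⟩, rfl⟩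
    choose l hl using hprod
    rw [eval_eq] at hxF
    have h1 : eval (coords x) G = ∑ d ∈ F.support, ((φ (F.coeff d) : L) : ℂ) * l d := by
      simp only [G, map_sum, eval_monomial]
      refine Finset.sum_congr rfl fun d _ => ?_
      rw [← hl]
      rfl
    have h2 : φ (∑ d ∈ F.support, l d • F.coeff d) = 0 := by
      rw [← map_zero φ, ← hxF]
      congr 1
      refine Finset.sum_congr rfl fun d _ => ?_
      rw [hl, mul_comm]
      rfl
    rw [h1]
    rw [map_sum] at h2
    have h3 := congrArg (fun z : L => (z : ℂ)) h2
    simp only [map_smul, smul_eq_mul] at h3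
    rw [← ZeroMemClass.coe_zero L, ← h3]
    push_cast
    exact Finset.sum_congr rfl fun d _ => mul_comm _ _
  refine ⟨G, ⟨n, hG⟩, ?_, fun d => ?_⟩
  · obtain ⟨H, hH⟩ := hdvd
    have hH0 : H ≠ 0 := by
      rintro rfl
      exact hG0 (by rw [hH, mul_zero])
    -- `F` and `G` have the same degree, so the cofactor is constant.
    have hdeg : H.totalDegree = 0 := by
      have := totalDegree_mul_of_isDomain hF'.ne_zero hH0
      rw [← hH, hG.totalDegree hG0, hn.totalDegree hF'.ne_zero] at this
      omega
    rw [totalDegree_eq_zero_iff_eq_C] at hdeg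
    rw [hdeg] at hH hH0
    refine ⟨(Ne.isUnit (a := H.coeff 0) (by rintro h0; exact hH0 (by rw [h0, C_0]))).map C |>.unit, ?_⟩
    rw [IsUnit.unit_spec, hH]
  · rw [hcoeff]
    exact mem_algebraicClosure_iff.mp (φ (F.coeff d)).2

end PlaneTorus

/-! ### A torsion coset on the curve -/

namespace PlaneTorus

open MvPolynomial

theorem finite_pow_eq_one {N : ℕ} (hN : N ≠ 0) : {x : Gm2 | x ^ N = 1}.Finite := by
  have : NeZero N := ⟨hN⟩
  have hfin : Finite (rootsOfUnity N ℂ) := inferInstance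
  have h : (rootsOfUnity N ℂ : Set ℂˣ).Finite := hfin
  refine (h.prod h).subset fun x hx => ⟨?_, ?_⟩
  · exact (mem_rootsOfUnity _ _).mpr (congrArg Prod.fst hx)
  · exact (mem_rootsOfUnity _ _).mpr (congrArg Prod.snd hx)

/-- An infinite set of torsion points contains points of arbitrarily large order. -/
theorem exists_orderOf_gt {Z : Set Gm2} (hZ : Z.Infinite) (hZ' : ∀ x ∈ Z, IsOfFinOrder x)
    (M : ℕ) : ∃ x ∈ Z, M < orderOf x := by
  by_contra! h
  refine hZ ((finite_pow_eq_one M.factorial_ne_zero).subset fun x hx => ?_)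
  exact orderOf_dvd_iff_pow_eq_one.mp (Nat.dvd_factorial (hZ' x hx).orderOf_pos (h x hx))

/-- A curve that contains many points of the subgroup `x ^ (g * a) * y ^ (g * b) = 1` contains one
of its components. -/
theorem exists_param_of_card {F : MvPolynomial (Fin 3) ℂ} {n : ℕ} (hF : F.IsHomogeneous n)
    {a b p q : ℤ} (h : p * a + q * b = 1) {g : ℕ} (hg : g ≠ 0) {S : Finset Gm2}
    (hS : ∀ Q ∈ S, eval (coords Q) F = 0 ∧ (Q.1 ^ a * Q.2 ^ b) ^ g = 1)
    (hcard : n * (2 * (a.natAbs + b.natAbs)) * g < S.card) :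
    ∃ w : ℂˣ, w ^ g = 1 ∧ ∀ t, eval (coords (param a b p q w t)) F = 0 := by
  classical
  by_contra! hcon
  have : NeZero g := ⟨hg⟩
  have hfin : Finite (rootsOfUnity g ℂ) := inferInstance
  let T : Finset ℂˣ := (Set.toFinite (rootsOfUnity g ℂ : Set ℂˣ)).toFinset
  have hT : T.card ≤ g := by
    rw [← Set.ncard_eq_toFinset_card _ (Set.toFinite _), ← Nat.card_coe_set_eq]
    exact card_rootsOfUnity ℂ g
  have hmem (w : ℂˣ) : w ∈ T ↔ w ^ g = 1 := by
    rw [Set.Finite.mem_toFinset, SetLike.mem_coe, mem_rootsOfUnity]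
  -- Counting by fibres of the character `x ^ a * y ^ b` over the `g`-th roots of unity; each fibre
  -- is one coset.
  have hle : S.card ≤ n * (2 * (a.natAbs + b.natAbs)) * T.card := by
    refine Finset.card_le_mul_card_image_of_maps_to (f := fun Q : Gm2 => Q.1 ^ a * Q.2 ^ b)
      (fun Q hQ => (hmem _).mpr (hS Q hQ).2) _ fun w hw => ?_
    rcases param_zeros hF a b p q w with h0 | ⟨hZ, hZn⟩
    · obtain ⟨t, ht⟩ := hcon w ((hmem w).mp hw)
      exact absurd (h0 t) ht
    · refine le_trans ?_ hZn
      rw [← Set.ncard_coe_finset,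
        ← Set.ncard_image_of_injective _ (param_injective h w)]
      refine Set.ncard_le_ncard ?_ (hZ.image _)
      intro Q hQ
      obtain ⟨hQS, rfl⟩ := Finset.mem_filter.mp hQ
      refine ⟨Q.1 ^ (-q) * Q.2 ^ p, ?_, (eq_param h Q).symm⟩
      rw [Set.mem_ofPred_eq, ← eq_param h Q]
      exact (hS Q hQS).1
  have := Nat.mul_le_mul_left (n * (2 * (a.natAbs + b.natAbs))) hT
  omega

/-- An irreducible curve with infinitely many torsion points contains a torsion coset. -/
theorem exists_param {F : MvPolynomial (Fin 3) ℂ} (hF : IsForm F) (hF' : Irreducible F)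
    (hinf : {x : Gm2 | IsOfFinOrder x ∧ eval (coords x) F = 0}.Infinite) :
    ∃ a b p q : ℤ, p * a + q * b = 1 ∧ ∃ w : ℂˣ, IsOfFinOrder w ∧
      ∀ t, eval (coords (param a b p q w t)) F = 0 := by
  obtain ⟨G, ⟨n, hG⟩, hFG, hGalg⟩ := exists_algebraic_form hF hF' hinf
  have hzero (v : Fin 3 → ℂ) : eval v F = 0 ↔ eval v G = 0 :=
    (hFG.map (eval v)).eq_zero_iff
  simp only [hzero] at hinf ⊢
  let K := IntermediateField.adjoin ℚ (G.coeffs : Set ℂ)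
  have hfd : FiniteDimensional ℚ K := by
    have : Finite (G.coeffs : Set ℂ) := inferInstance
    refine IntermediateField.finiteDimensional_adjoin fun c hc => ?_
    obtain ⟨d, -, rfl⟩ := mem_coeffs_iff.mp hc
    exact (hGalg d).isIntegral
  have hGK (d) : G.coeff d ∈ K := by
    by_cases hd : G.coeff d = 0
    · rw [hd]
      exact zero_mem K
    · exact IntermediateField.subset_adjoin _ _ (coeff_mem_coeffs d hd)
  set D := Module.finrank ℚ K with hD
  -- The threshold comes from `N ^ 3 ≤ 16 * φ(N) ^ 4 ≤ 16 * (D * 4n * √N) ^ 4`, which forces `N ≤ 16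
  -- * (D * 4n) ^ 4`.
  obtain ⟨P, ⟨hP, hPG⟩, hPN⟩ := exists_orderOf_gt hinf (fun x hx => hx.1) (16 * (D * (4 * n)) ^ 4)
  set N := orderOf P with hN
  have hN0 : N ≠ 0 := by omega
  have hPpow : P ^ N = 1 := pow_orderOf_eq_one P
  obtain ⟨S, hScard, hS⟩ := exists_conjugates hGK hN0 hN.symm hPG
  obtain ⟨a₀, b₀, hab0, ha₀, hb₀, hrel⟩ := exists_small_relation hN0
    (congrArg Prod.fst hPpow) (congrArg Prod.snd hPpow)
  have hg : Int.gcd a₀ b₀ ≠ 0 := by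
    rw [Ne, Int.gcd_eq_zero_iff]
    tauto
  -- Dividing by the gcd writes the relation as `(x ^ a * y ^ b) ^ g = 1` with `a`, `b` coprime.
  obtain ⟨a, ha⟩ := Int.gcd_dvd_left a₀ b₀
  obtain ⟨b, hb⟩ := Int.gcd_dvd_right a₀ b₀
  have hbez := Int.gcd_eq_gcd_ab a₀ b₀
  set g := Int.gcd a₀ b₀ with hgdef
  set p := Int.gcdA a₀ b₀
  set q := Int.gcdB a₀ b₀
  have hpq : p * a + q * b = 1 := by
    have h0 : (g : ℤ) ≠ 0 := by exact_mod_cast hg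
    apply mul_left_cancel₀ h0
    linear_combination -hbez - p * ha - q * hb
  have hgab : (a.natAbs + b.natAbs) * g = a₀.natAbs + b₀.natAbs := by
    rw [ha, hb, Int.natAbs_mul, Int.natAbs_mul, Int.natAbs_natCast]
    ring
  obtain ⟨w, hw, hw'⟩ : ∃ w : ℂˣ, w ^ g = 1 ∧
      ∀ t, eval (coords (param a b p q w t)) G = 0 := by
    refine exists_param_of_card hG hpq hg (fun Q hQ => ⟨(hS Q hQ).1, ?_⟩) ?_
    · have := (hS Q hQ).2 a₀ b₀ hrel
      rw [ha, hb, mul_comm (g : ℤ), mul_comm (g : ℤ), zpow_mul, zpow_mul, ← mul_zpow,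
        zpow_natCast] at this
      exact this
    · by_contra! hle
      have h1 : S.card ≤ 4 * n * N.sqrt := by
        calc S.card ≤ n * (2 * (a.natAbs + b.natAbs)) * g := hle
          _ = 2 * n * (a₀.natAbs + b₀.natAbs) := by rw [← hgab]; ring
          _ ≤ 2 * n * (N.sqrt + N.sqrt) := Nat.mul_le_mul_left _ (add_le_add ha₀ hb₀)
          _ = 4 * n * N.sqrt := by ring
      have h2 : N.totient ≤ D * (4 * n) * N.sqrt := by
        refine hScard.trans ?_
        rw [mul_assoc]
        exact Nat.mul_le_mul_left _ h1
      have h3 : N.sqrt ^ 4 ≤ N ^ 2 := by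
        have := Nat.pow_le_pow_left (Nat.sqrt_le' N) 2
        rwa [← pow_mul] at this
      have h4 : N * N ^ 2 ≤ 16 * (D * (4 * n)) ^ 4 * N ^ 2 := by
        calc N * N ^ 2 = N ^ 3 := by ring
          _ ≤ 16 * N.totient ^ 4 := Nat.cube_le_totient_pow_four hN0
          _ ≤ 16 * (D * (4 * n) * N.sqrt) ^ 4 :=
              Nat.mul_le_mul_left _ (Nat.pow_le_pow_left h2 4)
          _ = 16 * (D * (4 * n)) ^ 4 * N.sqrt ^ 4 := by ring
          _ ≤ _ := Nat.mul_le_mul_left _ h3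
      have := Nat.le_of_mul_le_mul_right h4 (by positivity)
      omega
  exact ⟨a, b, p, q, hpq, w, isOfFinOrder_iff_pow_eq_one.mpr ⟨g, Nat.pos_of_ne_zero hg, hw⟩, hw'⟩

end PlaneTorus

/-! ### Zariski topology and subtori -/

namespace PlaneTorus

open MvPolynomial hiding zeroLocus

theorem isClosed_zariski_iff {Z : Set P2} :
    IsClosed[zariski] Z ↔ ∃ S, (∀ F ∈ S, IsForm F) ∧ Z = zeroLocus S := by
  rw [← @isOpen_compl_iff _ _ zariski]
  change Zᶜᶜ ∈ _ ↔ _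
  rw [compl_compl]
  rfl

theorem isClosed_zariskiGm2_iff {Z : Set Gm2} :
    IsClosed[zariskiGm2] Z ↔
      ∃ S : Set (MvPolynomial (Fin 3) ℂ), (∀ F ∈ S, IsForm F) ∧
        Z = {x | ∀ F ∈ S, eval (coords x) F = 0} := by
  rw [@isClosed_induced_iff _ _ zariski]
  constructor
  · rintro ⟨_, hT, rfl⟩
    obtain ⟨S, hS, rfl⟩ := isClosed_zariski_iff.mp hT
    exact ⟨S, hS, Set.ext fun x => forall₂_congr fun F hF => vanishesAt_toP2 (hS F hF) x⟩
  · rintro ⟨S, hS, rfl⟩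
    exact ⟨zeroLocus S, isClosed_zariski_iff.mpr ⟨S, hS, rfl⟩,
      Set.ext fun x => forall₂_congr fun F hF => vanishesAt_toP2 (hS F hF) x⟩

theorem infinite_units : Infinite ℂˣ :=
  unitsEquivNeZero.infinite_iff.mpr (Set.finite_singleton (0 : ℂ)).infinite_compl.to_subtype

/-- The subgroup `x ^ a * y ^ b = 1` of the torus. -/
def charKer (a b : ℤ) : Subgroup Gm2 where
  carrier := {x | x.1 ^ a * x.2 ^ b = 1}
  one_mem' := by simp
  mul_mem' {x y} hx hy := by
    simp only [Set.mem_ofPred_eq] at hx hy ⊢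
    rw [Prod.fst_mul, Prod.snd_mul, mul_zpow, mul_zpow, mul_mul_mul_comm, hx, hy, one_mul]
  inv_mem' {x} hx := by
    simp only [Set.mem_ofPred_eq] at hx ⊢
    rw [Prod.fst_inv, Prod.snd_inv, inv_zpow, inv_zpow, ← mul_inv, hx, inv_one]

theorem mem_charKer {a b : ℤ} {x : Gm2} : x ∈ charKer a b ↔ x.1 ^ a * x.2 ^ b = 1 := Iff.rfl

theorem isSubtorus_charKer {a b p q : ℤ} (h : p * a + q * b = 1) : IsSubtorus (charKer a b) := by
  refine ⟨isClosed_zariskiGm2_iff.mpr ⟨{binomialForm a b 1}, ?_, ?_⟩, ⟨1, one_mem _⟩, ?_⟩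
  · rintro _ rfl
    exact isForm_binomialForm a b 1
  · ext x
    simp [eval_binomialForm, mem_charKer]
  · refine (@isPreconnected_closed_iff _ zariskiGm2 _).mpr ?_
    -- a closed set contains the image of the parametrization or meets it in a finite set
    have key (Z : Set Gm2) (hZ : IsClosed[zariskiGm2] Z) :
        (charKer a b : Set Gm2) ⊆ Z ∨ {t | param a b p q 1 t ∈ Z}.Finite := by
      obtain ⟨S, hS, rfl⟩ := isClosed_zariskiGm2_iff.mp hZ
      by_cases hall : ∀ F ∈ S, ∀ t, eval (coords (param a b p q 1 t)) F = 0
      · left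
        intro x hx F hF
        have := hall F hF (x.1 ^ (-q) * x.2 ^ p)
        rwa [← mem_charKer.mp hx, ← eq_param h x] at this
      · right
        push Not at hall
        obtain ⟨F, hF, t, ht⟩ := hall
        obtain ⟨n, hn⟩ := hS F hF
        rcases param_zeros hn a b p q 1 with h0 | h0
        · exact absurd (h0 t) ht
        · exact h0.1.subset fun t ht => ht F hF
    intro Z Z' hZ hZ' hcov hne hne'
    rcases key Z hZ with h1 | h1
    · obtain ⟨x, hx, hx'⟩ := hne'
      exact ⟨x, hx, h1 hx, hx'⟩
    rcases key Z' hZ' with h2 | h2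
    · obtain ⟨x, hx, hx'⟩ := hne
      exact ⟨x, hx, hx', h2 hx⟩
    -- In the remaining case the infinite parameter space `ℂˣ` would be a union of two finite sets.
    have := infinite_units
    refine absurd (h1.union h2) ?_
    rw [show {t | param a b p q 1 t ∈ Z} ∪ {t | param a b p q 1 t ∈ Z'} = Set.univ from
      Set.eq_univ_of_forall fun t => hcov (mem_charKer.mpr (param_pow h 1 t))]
    exact Set.infinite_univ

/-- The points of an irreducible curve on the torus are the solutions of `x ^ a * y ^ b = w` if
these all lie on the curve. -/
theorem eval_eq_zero_iff_of_param {F : MvPolynomial (Fin 3) ℂ} (hF : IsForm F)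
    (hF' : Irreducible F) {a b p q : ℤ} (h : p * a + q * b = 1) {w : ℂˣ}
    (hw : ∀ t, eval (coords (param a b p q w t)) F = 0) (x : Gm2) :
    eval (coords x) F = 0 ↔ x.1 ^ a * x.2 ^ b = w := by
  constructor
  · intro hx
    have := infinite_units
    obtain ⟨H, hH⟩ : F ∣ binomialForm a b w := by
      refine dvd_of_infinite hF hF' (isForm_binomialForm a b w)
        ((Set.infinite_range_of_injective (param_injective h w)).mono ?_)
      rintro _ ⟨t, rfl⟩
      exact ⟨hw t, (eval_binomialForm _ _ _ _).mpr (param_pow h w t)⟩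
    rw [← eval_binomialForm, hH, map_mul, hx, zero_mul]
  · intro hx
    rw [eq_param h x, hx]
    exact hw _

end PlaneTorus

/-! ### Conclusion -/

theorem mainTheorem10 (V : Set PlaneTorus.P2) (hV : PlaneTorus.IsIrreducibleCurve V)
    (hinf : {x : PlaneTorus.Gm2 | IsOfFinOrder x ∧ PlaneTorus.toP2 x ∈ V}.Infinite) :
    (∃ H : Subgroup PlaneTorus.Gm2, PlaneTorus.IsSubtorus H ∧
      ∃ t : PlaneTorus.Gm2, IsOfFinOrder t ∧
        V = closure[PlaneTorus.zariski] ((fun h => PlaneTorus.toP2 (t * h)) '' H)) ∧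
    (∃ a b : ℤ, IsCoprime a b ∧ ∃ u : ℂˣ, IsOfFinOrder u ∧
      {x : PlaneTorus.Gm2 | PlaneTorus.toP2 x ∈ V} =
        {x : PlaneTorus.Gm2 | x.1 ^ a * x.2 ^ b = u}) := by
  open PlaneTorus MvPolynomial in
  obtain ⟨F, hF, hF', rfl⟩ := hV
  simp only [Set.mem_ofPred_eq, vanishesAt_toP2 hF] at hinf ⊢
  obtain ⟨a, b, p, q, h, w, hw, hpar⟩ := exists_param hF hF' hinf
  have hiff := eval_eq_zero_iff_of_param hF hF' h hpar
  -- `(w ^ p, w ^ q)` is a torsion point on the coset, because `p * a + q * b = 1`.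
  refine ⟨⟨charKer a b, isSubtorus_charKer h, (w ^ p, w ^ q), ?_, ?_⟩,
    a, b, ⟨p, q, h⟩, w, hw, Set.ext hiff⟩
  · obtain ⟨n, hn, hwn⟩ := isOfFinOrder_iff_pow_eq_one.mp hw
    refine isOfFinOrder_iff_pow_eq_one.mpr ⟨n, hn, Prod.ext ?_ ?_⟩
    · change (w ^ p) ^ n = 1
      rw [← zpow_natCast, ← zpow_mul, mul_comm, zpow_mul, zpow_natCast, hwn, one_zpow]
    · change (w ^ q) ^ n = 1
      rw [← zpow_natCast, ← zpow_mul, mul_comm, zpow_mul, zpow_natCast, hwn, one_zpow]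
  · have hcoset : (fun x => toP2 ((w ^ p, w ^ q) * x)) '' (charKer a b : Set Gm2) =
        toP2 '' {x | x.1 ^ a * x.2 ^ b = w} := by
      have hmul (x : Gm2) : (((w ^ p, w ^ q) * x : Gm2).1) ^ a * (((w ^ p, w ^ q) * x : Gm2).2) ^ b
          = w * (x.1 ^ a * x.2 ^ b) := by
        simp only [Prod.fst_mul, Prod.snd_mul, mul_zpow, ← zpow_mul]
        rw [mul_mul_mul_comm, ← zpow_add, h, zpow_one]
      ext P
      constructor
      · rintro ⟨x, hx, rfl⟩
        exact ⟨_, by rw [Set.mem_ofPred_eq, hmul, mem_charKer.mp hx, mul_one], rfl⟩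
      · rintro ⟨x, hx, rfl⟩
        refine ⟨(w ^ p, w ^ q)⁻¹ * x, ?_, congrArg toP2 (mul_inv_cancel_left _ _)⟩
        have := hmul ((w ^ p, w ^ q)⁻¹ * x)
        rw [mul_inv_cancel_left, hx] at this
        exact mem_charKer.mpr (mul_eq_left.mp this.symm)
    rw [hcoset]
    apply Set.Subset.antisymm
    · intro P hP
      rintro Z ⟨hZ, hsub⟩
      obtain ⟨S, hS, rfl⟩ := isClosed_zariski_iff.mp hZ
      intro G hG
      have := infinite_units
      -- Any form vanishing on the coset shares infinitely many zeros with `F`, hence is a multiple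
      -- of `F` and vanishes on the whole curve, including its points outside the torus.
      obtain ⟨H, hH⟩ : F ∣ G := by
        refine dvd_of_infinite hF hF' (hS G hG)
          ((Set.infinite_range_of_injective (param_injective h w)).mono ?_)
        rintro _ ⟨t, rfl⟩
        exact ⟨hpar t, (vanishesAt_toP2 (hS G hG) _).mp
          (hsub ⟨_, param_pow h w t, rfl⟩ G hG)⟩
      have hP' : eval P.rep F = 0 := hP
      rw [VanishesAt, hH, map_mul, hP', zero_mul]
    · refine @closure_minimal _ zariski _ _ ?_
        (isClosed_zariski_iff.mpr ⟨{F}, by simpa using hF, by simp [PlaneTorus.zeroLocus]⟩)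
      rintro _ ⟨x, hx, rfl⟩
      exact (vanishesAt_toP2 hF x).mpr ((hiff x).mpr hx)
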